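/- Let $G=(V,E)$ be a finite simple undirected graph (not necessarily connected), whose edges are unordered pairs of distinct nodes, and let $A\in\mathbb{R}^{|V|\times|E|}$ be its signed incidence matrix with arc directions designated arbitrarily. Let $I\subseteq V$, $L\subseteq E$ and $P\subseteq V$ (the protected injections, protected line power flows and protected PMU phasors, respectively), and suppose that no node of $I\cap P$ is isolated in $G$. Let $M_I$, $M_L$ and $M_P$ be the submatrices of the $|V|\times|V|$, $|E|\times|E|$ and $|V|\times|V|$ identity matrices consisting of the rows indexed by $I$, $L$ and $P$, respectively. For a diagonal matrix $\tilde D\in\mathbb{R}^{|E|\times|E|}$ put $$H_p(\tilde D)=\begin{bmatrix} M_I A\tilde D A^T\\ M_L\tilde D A^T\\ M_P\end{bmatrix}.$$ Let $0$ be an additional node not in $V$, and let $E_{P0}=\{\{i,0\}\mid i\in P\}$. Then the following two conditions are equivalent: (i) $H_p(\tilde D)$ has full column rank $|V|$ for almost all real diagonal $\tilde D$ (that is, for all vectors of diagonal entries in $\mathbb{R}^{E}$ outside a set of Lebesgue measure zero); (ii) there exists a function $g:I\to E$ with $i\in g(i)$ for all $i\in I$ such that the graph $(V\cup\{0\},\,L\cup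 E_{P0}\cup g(I))$ is connected, where $g(I)=\{g(i)\mid i\in I\}$. -/

import Mathlib

open scoped Matrix

namespace PowerNetwork

/-- An arbitrary designation of arc directions for the edges of a simple graph `G`:
each edge `e = {tail e, head e}` is directed from `tail e` to `head e`. -/
structure ArcDirection {V : Type*} (G : SimpleGraph V) where
  /-- the start node of the arc -/
  tail : G.edgeSet → V
  /-- the end node of the arc -/
  head : G.edgeSet → V
  /-- the two end nodes of the arc are those of the edge -/
  spec : ∀ e : G.edgeSet, s(tail e, head e) = (e : Sym2 V)

/-- The signed (bus-by-line) incidence matrix: `+1` at the tail, `-1` at the head,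
`0` elsewhere. Tail and head of an edge differ since `G` has no loops. -/
def signedIncMatrix {V : Type*} [DecidableEq V] {G : SimpleGraph V} (o : ArcDirection G) :
    Matrix V G.edgeSet ℝ :=
  Matrix.of fun v e => if v = o.tail e then 1 else if v = o.head e then -1 else 0

/-- The submatrix of the identity matrix on `ι` made of the rows in `S`. -/
def selectRows {ι : Type*} [DecidableEq ι] (S : Set ι) : Matrix S ι ℝ :=
  (1 : Matrix ι ι ℝ).submatrix Subtype.val id

/-- The protected measurement matrix `[M_I A D Aᵀ; M_L D Aᵀ; M_P]` with `D = diag d`. -/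
def protectedMatrix {V : Type*} [Fintype V] [DecidableEq V] {G : SimpleGraph V}
    [Fintype G.edgeSet] (o : ArcDirection G) (I : Set V) (L : Set G.edgeSet) (P : Set V)
    (d : G.edgeSet → ℝ) : Matrix (I ⊕ L ⊕ P) V ℝ :=
  Matrix.fromRows
    (selectRows I * signedIncMatrix o * Matrix.diagonal d * (signedIncMatrix o)ᵀ)
    (Matrix.fromRows
      (selectRows L * Matrix.diagonal d * (signedIncMatrix o)ᵀ)
      (selectRows P))

/-- Topological observability: the protected measurement matrix has full column rank for
Lebesgue-almost all diagonal matrices, i.e. for almost all vectors of diagonal entries. -/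
def TopologicallyObservable {V : Type*} [Fintype V] [DecidableEq V] {G : SimpleGraph V}
    [Fintype G.edgeSet] (o : ArcDirection G) (I : Set V) (L : Set G.edgeSet) (P : Set V) :
    Prop :=
  ∀ᵐ d : G.edgeSet → ℝ ∂MeasureTheory.volume,
    (protectedMatrix o I L P d).rank = Fintype.card V

/-- An edge of `G` regarded as an edge on the enlarged node set `V ∪ {0}`, which is
`Option V` with `none` in the role of the additional node `0`. -/
def liftEdge {V : Type*} {G : SimpleGraph V} (e : G.edgeSet) : Sym2 (Option V) :=
  Sym2.map some (e : Sym2 V)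

/-- The set `E_{P0} = {{i, 0} | i ∈ P}` of edges joining the buses of `P` to node `0`. -/
def phasorEdges {V : Type*} (P : Set V) : Set (Sym2 (Option V)) :=
  {x | ∃ i ∈ P, x = s(some i, none)}

/-- The graph `(V ∪ {0}, L ∪ E_{P0} ∪ g(I))`. -/
def augmentedGraph {V : Type*} {G : SimpleGraph V} {I : Set V} (L : Set G.edgeSet)
    (P : Set V) (g : I → G.edgeSet) : SimpleGraph (Option V) :=
  SimpleGraph.fromEdgeSet (liftEdge '' L ∪ phasorEdges P ∪ liftEdge '' Set.range g)

end PowerNetwork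

/-! Full column rank is the nonvanishing of a Gram determinant, a polynomial in the line weights, so
one good weight vector suffices. Let K be the space of grounded potentials. By
`augmentedGraph_connected_iff`, (ii) asks that the differences along the lines g(i) separate K from
zero; (i) asks this of the injections at `I`, for some weights.

(i) ⇒ (ii): the injection at i is a combination of differences along lines at i, so injections can
be exchanged for such differences one at a time (`exists_transversal_linear_tests`).

(ii) ⇒ (i): give weight 1 to `L` and to an irredundant subfamily of the chosen lines, 0 to the rest.
An undetected nonzero potential would produce a nonempty set S of buses whose chosen lines have all
ends in S. That is |S| lines on |S| buses, so their differences are dependent, against irredundancy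
(`exists_weights_of_forall_eq_zero`). -/

/-! ### Generic nonvanishing and generic rank -/

open MeasureTheory in
/-- A multivariate real polynomial that does not vanish identically is almost everywhere
nonzero. -/
theorem MvPolynomial.ae_eval_ne_zero {σ : Type*} [Fintype σ] (p : MvPolynomial σ ℝ)
    {a : σ → ℝ} (ha : MvPolynomial.eval a p ≠ 0) :
    ∀ᵐ x : σ → ℝ, MvPolynomial.eval x p ≠ 0 := by
  -- On a line through `a` the polynomial in `t` is nonzero at `t = 0`, hence has finitely many
  -- roots.
  have hline (x : σ → ℝ) : ∀ᵐ t : ℝ, MvPolynomial.eval (a + t • x) p ≠ 0 := by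
    let q : Polynomial ℝ :=
      MvPolynomial.aeval (fun i => Polynomial.C (a i) + Polynomial.X * Polynomial.C (x i)) p
    have hq (t : ℝ) : q.eval t = MvPolynomial.eval (a + t • x) p := by
      rw [← Polynomial.coe_evalRingHom, MvPolynomial.map_aeval, MvPolynomial.eval]
      congr 2
      · ext r; simp
      · ext i; simp [mul_comm t]
    have hq0 : q ≠ 0 := fun h => ha (by simpa [h] using (hq 0).symm)
    have hfin : {t : ℝ | q.eval t = 0}.Finite :=
      (q.roots.toFinset.finite_toSet).subset fun t ht => by simpa [hq0] using ht
    filter_upwards [hfin.countable.ae_notMem volume] with t ht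
    rw [← hq]
    exact ht
  have hcont : Continuous fun x : σ → ℝ => MvPolynomial.eval x p := MvPolynomial.continuous_eval p
  have hmeas : MeasurableSet
      {z : (σ → ℝ) × ℝ | MvPolynomial.eval (a + z.2 • z.1) p ≠ 0} :=
    (isOpen_ne.preimage (hcont.comp (by fun_prop :
      Continuous fun z : (σ → ℝ) × ℝ => a + z.2 • z.1))).measurableSet
  -- By Fubini some fixed `t ≠ 0` works for almost all `x`; scaling by `t` and translating by `a`
  -- preserve null sets.
  have hcomm := (Measure.ae_ae_comm (μ := (volume : Measure (σ → ℝ)))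
    (ν := (volume : Measure ℝ)) hmeas).1 (Filter.Eventually.of_forall hline)
  have hne : ∀ᵐ t : ℝ, t ≠ 0 := by
    simpa using (Set.countable_singleton (0 : ℝ)).ae_notMem volume
  obtain ⟨t, ht, ht0⟩ := (hcomm.and hne).exists
  have hsmul : ∀ᵐ y : σ → ℝ, MvPolynomial.eval (a + y) p ≠ 0 := by
    have hpre := (Measure.addHaar_preimage_smul (volume : Measure (σ → ℝ)) ht0
      {y | ¬ MvPolynomial.eval (a + y) p ≠ 0})
    have hzero : volume ((t • ·) ⁻¹' {y : σ → ℝ | ¬ MvPolynomial.eval (a + y) p ≠ 0}) = 0 := ht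
    rw [hpre, mul_eq_zero] at hzero
    refine hzero.resolve_left ?_
    simp [ht0]
  have := (measurePreserving_add_left (volume : Measure (σ → ℝ)) (-a)).quasiMeasurePreserving.ae
    hsmul
  simpa using this

namespace Matrix

/-- A matrix has full column rank iff its kernel is trivial. -/
theorem rank_eq_card_iff {m n K : Type*} [Fintype n] [Field K] (M : Matrix m n K) :
    M.rank = Fintype.card n ↔ ∀ x, M *ᵥ x = 0 → x = 0 := by
  have h := LinearMap.finrank_range_add_finrank_ker M.mulVecLin
  rw [Module.finrank_fintype_fun_eq_card] at h
  have hr : M.rank = Module.finrank K (LinearMap.range M.mulVecLin) := rfl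
  have hk : (∀ x, M *ᵥ x = 0 → x = 0) ↔ LinearMap.ker M.mulVecLin = ⊥ := by
    rw [LinearMap.ker_eq_bot']; rfl
  rw [hk, ← Submodule.finrank_eq_zero (R := K)]
  omega

/-- Turns full column rank into the nonvanishing of one polynomial in the entries, with no choice of
a minor. -/
theorem det_transpose_mul_self_ne_zero_iff {m n : Type*} [Fintype m] [Fintype n] [DecidableEq n]
    (M : Matrix m n ℝ) : (Mᵀ * M).det ≠ 0 ↔ M.rank = Fintype.card n := by
  rw [← rank_transpose_mul_self, rank_eq_card_iff, ne_eq, ← exists_mulVec_eq_zero_iff]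
  push Not
  exact forall_congr' fun x => not_imp_not

end Matrix

/-- If the entries of a matrix depend polynomially on real parameters, full column rank at one
parameter vector implies full column rank at almost all of them. -/
theorem ae_rank_eq_card_of_polynomial {m n σ : Type*} [Fintype m] [Fintype n] [Fintype σ]
    (M : (σ → ℝ) → Matrix m n ℝ)
    (hM : ∀ i j, ∃ p : MvPolynomial σ ℝ, ∀ d, M d i j = MvPolynomial.eval d p)
    {a : σ → ℝ} (ha : (M a).rank = Fintype.card n) :
    ∀ᵐ d : σ → ℝ, (M d).rank = Fintype.card n := by
  classical
  choose p hp using hM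
  let Q : Matrix m n (MvPolynomial σ ℝ) := Matrix.of p
  have hQ (d : σ → ℝ) : MvPolynomial.eval d (Qᵀ * Q).det = ((M d)ᵀ * M d).det := by
    rw [RingHom.map_det, RingHom.mapMatrix_apply, Matrix.map_mul]
    congr 2 <;> (ext i j; simp [Q, hp])
  have := MvPolynomial.ae_eval_ne_zero (Qᵀ * Q).det (a := a)
    (by rwa [hQ, Matrix.det_transpose_mul_self_ne_zero_iff])
  filter_upwards [this] with d hd
  rwa [hQ, Matrix.det_transpose_mul_self_ne_zero_iff] at hd

/-- A square matrix with zero row sums has linearly dependent rows. -/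
theorem Matrix.exists_vecMul_eq_zero_of_row_sum_eq_zero {n K : Type*} [Fintype n] [Nonempty n]
    [Field K] (M : Matrix n n K) (hM : ∀ i, ∑ j, M i j = 0) :
    ∃ c : n → K, c ≠ 0 ∧ c ᵥ* M = 0 := by
  classical
  rw [Matrix.exists_vecMul_eq_zero_iff, ← Matrix.exists_mulVec_eq_zero_iff]
  refine ⟨1, one_ne_zero, ?_⟩
  ext i
  simpa [Matrix.mulVec, dotProduct] using hM i

/-! ### Exchange of separating functionals -/

/-- Linear functionals `φ i` that jointly separate the elements of `K` from zero contain a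
subfamily with this property of which no member can be dispensed with. -/
theorem exists_minimal_linear_tests {F X ι : Type*} [Field F] [AddCommGroup X] [Module F X]
    [Fintype ι] (K : Submodule F X) (φ : ι → X →ₗ[F] F)
    (h : ∀ x ∈ K, (∀ i, φ i x = 0) → x = 0) :
    ∃ T : Finset ι, (∀ x ∈ K, (∀ i ∈ T, φ i x = 0) → x = 0) ∧
      ∀ k ∈ T, ∃ y ∈ K, (∀ i ∈ T, i ≠ k → φ i y = 0) ∧ φ k y ≠ 0 := by
  classical
  obtain ⟨T, hT⟩ := Set.Finite.exists_minimal
    (s := {T : Finset ι | ∀ x ∈ K, (∀ i ∈ T, φ i x = 0) → x = 0})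
    (Set.toFinite _) ⟨Finset.univ, fun x hx hφ => h x hx fun i => hφ i (Finset.mem_univ i)⟩
  refine ⟨T, hT.prop, fun k hk => ?_⟩
  have hnot := hT.not_prop_of_lt (Finset.erase_ssubset hk)
  simp only [Set.mem_ofPred_eq, Finset.mem_erase] at hnot
  push Not at hnot
  obtain ⟨y, hyK, hy, hy0⟩ := hnot
  refine ⟨y, hyK, fun i hi hik => hy i ⟨hik, hi⟩, fun hyk => hy0 (hT.prop y hyK fun i hi => ?_)⟩
  by_cases hik : i = k
  exacts [hik ▸ hyk, hy i ⟨hik, hi⟩]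

/-- If a functional `r` separates the elements of `K` from zero and vanishes wherever a nonempty
family of functionals vanishes, then some member of that family separates them as well. -/
theorem exists_linear_test {F X E : Type*} [Field F] [AddCommGroup X] [Module F X]
    (K : Submodule F X) (r : X →ₗ[F] F) (φ : E → X →ₗ[F] F) (S : Set E) (hS : S.Nonempty)
    (hr : ∀ x, (∀ e ∈ S, φ e x = 0) → r x = 0) (h : ∀ x ∈ K, r x = 0 → x = 0) :
    ∃ e ∈ S, ∀ x ∈ K, φ e x = 0 → x = 0 := by
  by_cases hK : ∃ x ∈ K, x ≠ 0
  · obtain ⟨x, hxK, hx⟩ := hK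
    obtain ⟨e, he, hex⟩ : ∃ e ∈ S, φ e x ≠ 0 := by
      by_contra! hall
      exact hx (h x hxK (hr x hall))
    refine ⟨e, he, fun y hyK hy => h y hyK ?_⟩
    -- Since `r` is injective on `K`, any two elements are proportional, so one `φ e` nonzero at `x`
    -- suffices.
    have hz := h (r y • x - r x • y) (K.sub_mem (K.smul_mem _ hxK) (K.smul_mem _ hyK))
      (by simp [mul_comm])
    have := congrArg (φ e) hz
    simpa [hy, hex] using this
  · push Not at hK
    exact ⟨_, hS.some_mem, fun x hx _ => hK x hx⟩

/-- If the functionals `r i` jointly separate the elements of `K` from zero and each `r i`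
vanishes wherever all `φ e` with `e ∈ S i` vanish, then one can choose an `e` in each `S i` so
that the chosen `φ e` jointly separate the elements of `K` from zero. -/
theorem exists_transversal_linear_tests {F X ι E : Type*} [Field F] [AddCommGroup X]
    [Module F X] [Finite ι] (K : Submodule F X) (r : ι → X →ₗ[F] F) (φ : E → X →ₗ[F] F)
    (S : ι → Set E) (hS : ∀ i, (S i).Nonempty)
    (hr : ∀ i x, (∀ e ∈ S i, φ e x = 0) → r i x = 0)
    (h : ∀ x ∈ K, (∀ i, r i x = 0) → x = 0) :
    ∃ g : ι → E, (∀ i, g i ∈ S i) ∧ ∀ x ∈ K, (∀ i, φ (g i) x = 0) → x = 0 := by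
  classical
  have := Fintype.ofFinite ι
  -- Hybrid statement: the functionals indexed by `T` are already exchanged, the others are still `r
  -- i`.
  suffices H : ∀ T : Finset ι, ∃ g : ι → E, (∀ i, g i ∈ S i) ∧
      ∀ x ∈ K, (∀ i ∈ T, φ (g i) x = 0) → (∀ i ∉ T, r i x = 0) → x = 0 by
    obtain ⟨g, hg, hx⟩ := H Finset.univ
    exact ⟨g, hg, fun x hxK hφ => hx x hxK (fun i _ => hφ i) (by simp)⟩
  intro T
  induction T using Finset.induction_on with
  | empty => exact ⟨fun i => (hS i).some, fun i => (hS i).some_mem, fun x hx _ hr' =>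
      h x hx fun i => hr' i (by simp)⟩
  | insert k T hk ih =>
    obtain ⟨g, hg, ih⟩ := ih
    let K' : Submodule F X := K ⊓ (⨅ i ∈ T, LinearMap.ker (φ (g i))) ⊓
      ⨅ i ∈ {i | i ∉ T ∧ i ≠ k}, LinearMap.ker (r i)
    have hK' (x : X) : x ∈ K' ↔ (x ∈ K ∧ ∀ i ∈ T, φ (g i) x = 0) ∧
        ∀ i, i ∉ T ∧ i ≠ k → r i x = 0 := by
      simp [K', Submodule.mem_iInf]
    obtain ⟨e, he, hek⟩ := exists_linear_test K' (r k) φ (S k) (hS k) (hr k) fun x hx hrk => by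
      rw [hK'] at hx
      refine ih x hx.1.1 hx.1.2 fun i hi => ?_
      by_cases hik : i = k
      exacts [hik ▸ hrk, hx.2 i ⟨hi, hik⟩]
    refine ⟨Function.update g k e, fun i => ?_, fun x hxK hφ hr' => ?_⟩
    · obtain rfl | hik := eq_or_ne i k
      · simpa using he
      · simpa [hik] using hg i
    · refine hek x ((hK' x).2 ⟨⟨hxK, fun i hi => ?_⟩, fun i hi => ?_⟩) ?_
      · have hik : i ≠ k := fun h => hk (h ▸ hi)
        simpa [hik] using hφ i (Finset.mem_insert_of_mem hi)
      · exact hr' i (by simp [hi.1, hi.2])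
      · simpa using hφ k (Finset.mem_insert_self k T)

/-! ### Potentials and connectivity -/

namespace PowerNetwork

variable {V : Type*} {G : SimpleGraph V}

/-- The difference of a node potential along an arc. -/
def arcDifference (o : ArcDirection G) (e : G.edgeSet) : (V → ℝ) →ₗ[ℝ] ℝ :=
  (LinearMap.proj (o.tail e) : (V → ℝ) →ₗ[ℝ] ℝ) - LinearMap.proj (o.head e)

theorem arcDifference_apply (o : ArcDirection G) (e : G.edgeSet) (x : V → ℝ) :
    arcDifference o e x = x (o.tail e) - x (o.head e) := rfl

theorem ArcDirection.tail_ne_head (o : ArcDirection G) (e : G.edgeSet) :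
    o.tail e ≠ o.head e := by
  have h := e.2
  rw [← o.spec e, SimpleGraph.mem_edgeSet] at h
  exact h.ne

theorem ArcDirection.mem_iff (o : ArcDirection G) (e : G.edgeSet) (v : V) :
    v ∈ (e : Sym2 V) ↔ v = o.tail e ∨ v = o.head e := by
  rw [← o.spec e, Sym2.mem_iff]

/-- The potentials that vanish on the buses of `P` and are constant along the lines of `L`. -/
def groundedPotentials (o : ArcDirection G) (L : Set G.edgeSet) (P : Set V) :
    Submodule ℝ (V → ℝ) where
  carrier := {x | (∀ l ∈ L, arcDifference o l x = 0) ∧ ∀ v ∈ P, x v = 0}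
  add_mem' := fun {x y} hx hy =>
    ⟨fun l hl => by simp [hx.1 l hl, hy.1 l hl], fun v hv => by simp [hx.2 v hv, hy.2 v hv]⟩
  zero_mem' := by simp
  smul_mem' := fun c x hx =>
    ⟨fun l hl => by simp [hx.1 l hl], fun v hv => by simp [hx.2 v hv]⟩

/-- The augmented graph is connected iff a grounded potential that is constant along the chosen
lines is zero. -/
theorem augmentedGraph_connected_iff (o : ArcDirection G) {I : Set V} (L : Set G.edgeSet)
    (P : Set V) (g : I → G.edgeSet) :
    (augmentedGraph L P g).Connected ↔
      ∀ x ∈ groundedPotentials o L P, (∀ i, arcDifference o (g i) x = 0) → x = 0 := by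
  constructor
  · rintro h x ⟨hL, hP⟩ hg
    let y : Option V → ℝ := fun v => v.elim 0 x
    have hlift (e : G.edgeSet) (he : arcDifference o e x = 0) (u v : Option V)
        (huv : liftEdge e = s(u, v)) : y u = y v := by
      rw [liftEdge, ← o.spec e, Sym2.map_mk, Sym2.eq_iff] at huv
      have := sub_eq_zero.1 he
      obtain ⟨rfl, rfl⟩ | ⟨rfl, rfl⟩ := huv
      exacts [this, this.symm]
    have hadj (u v : Option V) (huv : (augmentedGraph L P g).Adj u v) : y u = y v := by
      rw [augmentedGraph, SimpleGraph.fromEdgeSet_adj] at huv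
      obtain ⟨(⟨e, he, heq⟩ | ⟨i, hi, heq⟩) | ⟨_, ⟨i, rfl⟩, heq⟩, -⟩ := huv
      · exact hlift e (hL e he) u v heq
      · rw [Sym2.eq_iff] at heq
        obtain ⟨rfl, rfl⟩ | ⟨rfl, rfl⟩ := heq
        exacts [hP i hi, (hP i hi).symm]
      · exact hlift _ (hg i) u v heq
    have hreach (u v : Option V) (huv : (augmentedGraph L P g).Reachable u v) : y u = y v := by
      obtain ⟨w⟩ := huv
      induction w with
      | nil => rfl
      | cons h _ ih => exact (hadj _ _ h).trans ih
    ext v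
    exact hreach (some v) none (h.preconnected _ _)
  · classical
    intro h
    -- The indicator of the buses outside the component of node 0.
    let x : V → ℝ := fun v => if (augmentedGraph L P g).Reachable (some v) none then 0 else 1
    have hedge (e : G.edgeSet)
        (he : liftEdge e ∈ liftEdge '' L ∪ phasorEdges P ∪ liftEdge '' Set.range g) :
        arcDifference o e x = 0 := by
      have hadj : (augmentedGraph L P g).Adj (some (o.tail e)) (some (o.head e)) := by
        rw [augmentedGraph, SimpleGraph.fromEdgeSet_adj]
        refine ⟨?_, fun h => o.tail_ne_head e (Option.some_injective _ h)⟩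
        rwa [liftEdge, ← o.spec e, Sym2.map_mk] at he
      have : (augmentedGraph L P g).Reachable (some (o.tail e)) none ↔
          (augmentedGraph L P g).Reachable (some (o.head e)) none :=
        ⟨hadj.reachable.symm.trans, hadj.reachable.trans⟩
      simp [arcDifference_apply, x, this]
    have hx : x = 0 := by
      refine h x ⟨fun l hl => hedge l (Or.inl (Or.inl ⟨l, hl, rfl⟩)), fun v hv => ?_⟩
        fun i => hedge _ (Or.inr ⟨_, ⟨i, rfl⟩, rfl⟩)
      have hadj : (augmentedGraph L P g).Adj (some v) none := by
        rw [augmentedGraph, SimpleGraph.fromEdgeSet_adj]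
        exact ⟨Or.inl (Or.inr ⟨v, hv, rfl⟩), by simp⟩
      simp [x, hadj.reachable]
    have hreach (v : Option V) : (augmentedGraph L P g).Reachable v none := by
      cases v with
      | none => exact .refl _
      | some v =>
        by_contra hv
        simpa [x, hv] using congrFun hx v
    exact { preconnected := fun u v => (hreach u).trans (hreach v).symm }

variable [DecidableEq V]

theorem signedIncMatrix_ne_zero_iff (o : ArcDirection G) (v : V) (e : G.edgeSet) :
    signedIncMatrix o v e ≠ 0 ↔ v ∈ (e : Sym2 V) := by
  rw [o.mem_iff, signedIncMatrix, Matrix.of_apply]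
  split_ifs <;> simp_all

/-- Stated for an injection `f` so that the sum may run over all buses or only over a subset
containing both ends of the line. -/
theorem sum_signedIncMatrix_mul (o : ArcDirection G) {ι : Type*} [Fintype ι] {f : ι → V}
    (hf : Function.Injective f) {e : G.edgeSet} {a b : ι} (ha : f a = o.tail e)
    (hb : f b = o.head e) (x : V → ℝ) :
    ∑ i, signedIncMatrix o (f i) e * x (f i) = arcDifference o e x := by
  classical
  have hne : a ≠ b := fun h => o.tail_ne_head e (by rw [← ha, ← hb, h])
  have hterm (i : ι) : signedIncMatrix o (f i) e * x (f i) =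
      (if i = a then x (f i) else 0) - if i = b then x (f i) else 0 := by
    rw [signedIncMatrix, Matrix.of_apply, ← ha, ← hb]
    simp only [hf.eq_iff]
    split_ifs <;> simp_all
  simp [hterm, Finset.sum_sub_distrib, arcDifference_apply, ha, hb]

theorem arcDifference_eq_sum [Fintype V] (o : ArcDirection G) (e : G.edgeSet) (x : V → ℝ) :
    arcDifference o e x = ∑ v, signedIncMatrix o v e * x v :=
  (sum_signedIncMatrix_mul o Function.injective_id (a := o.tail e) (b := o.head e) rfl rfl x).symm

theorem signedIncMatrix_transpose_mulVec [Fintype V] (o : ArcDirection G) (x : V → ℝ) :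
    (signedIncMatrix o)ᵀ *ᵥ x = fun e => arcDifference o e x :=
  funext fun e => (arcDifference_eq_sum o e x).symm

/-! ### Injections and the measurement matrix -/

variable [Fintype G.edgeSet]

/-- The power injected at the bus `v` by a potential when the line weights are `d`. -/
def injection (o : ArcDirection G) (d : G.edgeSet → ℝ) (v : V) : (V → ℝ) →ₗ[ℝ] ℝ :=
  ∑ e, (signedIncMatrix o v e * d e) • arcDifference o e

theorem injection_apply (o : ArcDirection G) (d : G.edgeSet → ℝ) (v : V) (x : V → ℝ) :
    injection o d v x = ∑ e, signedIncMatrix o v e * (d e * arcDifference o e x) := by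
  simp [injection, mul_assoc]

variable [Fintype V]

theorem selectRows_mulVec {ι : Type*} [Fintype ι] [DecidableEq ι] (S : Set ι) (x : ι → ℝ) :
    selectRows S *ᵥ x = fun i : S => x i := by
  ext i
  simp [selectRows, Matrix.mulVec, dotProduct, Matrix.one_apply]

theorem protectedMatrix_mulVec (o : ArcDirection G) (I : Set V) (L : Set G.edgeSet)
    (P : Set V) (d : G.edgeSet → ℝ) (x : V → ℝ) :
    protectedMatrix o I L P d *ᵥ x =
      Sum.elim (fun i : I => injection o d i x)
        (Sum.elim (fun l : L => d l * arcDifference o l x) fun v : P => x v) := by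
  have hdiag : (Matrix.diagonal d *ᵥ fun e => arcDifference o e x) =
      fun e => d e * arcDifference o e x :=
    funext fun e => Matrix.mulVec_diagonal d _ e
  have hinj : (signedIncMatrix o *ᵥ fun e => d e * arcDifference o e x) =
      fun v => injection o d v x :=
    funext fun v => (injection_apply o d v x).symm
  unfold protectedMatrix
  rw [Matrix.fromRows_mulVec, Matrix.fromRows_mulVec]
  simp only [← Matrix.mulVec_mulVec, signedIncMatrix_transpose_mulVec, hdiag,
    selectRows_mulVec, hinj]

theorem protectedMatrix_mulVec_eq_zero_iff (o : ArcDirection G) (I : Set V) (L : Set G.edgeSet)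
    (P : Set V) (d : G.edgeSet → ℝ) (x : V → ℝ) :
    protectedMatrix o I L P d *ᵥ x = 0 ↔
      (∀ i ∈ I, injection o d i x = 0) ∧ (∀ l ∈ L, d l * arcDifference o l x = 0) ∧
        ∀ v ∈ P, x v = 0 := by
  rw [protectedMatrix_mulVec, funext_iff]
  simp [Sum.forall]

theorem exists_mvPolynomial_protectedMatrix (o : ArcDirection G) (I : Set V)
    (L : Set G.edgeSet) (P : Set V) (r : I ⊕ L ⊕ P) (v : V) :
    ∃ p : MvPolynomial G.edgeSet ℝ, ∀ d, protectedMatrix o I L P d r v = MvPolynomial.eval d p := by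
  have hcol (d : G.edgeSet → ℝ) :
      protectedMatrix o I L P d r v = (protectedMatrix o I L P d *ᵥ Pi.single v 1) r := by
    simp
  simp only [hcol, protectedMatrix_mulVec]
  obtain i | l | w := r
  · refine ⟨∑ e, MvPolynomial.C (signedIncMatrix o i e) *
      (MvPolynomial.X e * MvPolynomial.C (arcDifference o e (Pi.single v 1))), fun d => ?_⟩
    simp [injection_apply]
  · refine ⟨MvPolynomial.X (l : G.edgeSet) *
      MvPolynomial.C (arcDifference o l (Pi.single v 1)), fun d => ?_⟩
    simp only [Sum.elim_inr, Sum.elim_inl, map_mul, MvPolynomial.eval_X, MvPolynomial.eval_C]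
  · exact ⟨MvPolynomial.C ((Pi.single v 1 : V → ℝ) w), fun d => (MvPolynomial.eval_C _).symm⟩

/-- Full column rank for a single choice of the line weights is enough for topological
observability. -/
theorem topologicallyObservable_iff_exists (o : ArcDirection G) (I : Set V)
    (L : Set G.edgeSet) (P : Set V) :
    TopologicallyObservable o I L P ↔
      ∃ d, (protectedMatrix o I L P d).rank = Fintype.card V := by
  classical
  have := Fintype.ofFinite I
  have := Fintype.ofFinite L
  have := Fintype.ofFinite P
  exact ⟨fun h => h.exists, fun ⟨_, hd⟩ => ae_rank_eq_card_of_polynomial _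
    (exists_mvPolynomial_protectedMatrix o I L P) hd⟩

/-! ### Weights from chosen lines -/

/-- Lines chosen at the buses of `I` so that grounded potentials constant along them vanish
yield line weights for which the injections at `I` detect all grounded potentials. -/
theorem exists_weights_of_forall_eq_zero (o : ArcDirection G) (I : Set V) (L : Set G.edgeSet)
    (P : Set V) (g : I → G.edgeSet) (hg : ∀ i : I, (i : V) ∈ (g i : Sym2 V))
    (h : ∀ x ∈ groundedPotentials o L P, (∀ i, arcDifference o (g i) x = 0) → x = 0) :
    ∃ d : G.edgeSet → ℝ, (∀ l ∈ L, d l ≠ 0) ∧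
      ∀ x ∈ groundedPotentials o L P, (∀ i ∈ I, injection o d i x = 0) → x = 0 := by
  classical
  have := Fintype.ofFinite I
  obtain ⟨T, hT, hmin⟩ := exists_minimal_linear_tests (groundedPotentials o L P)
    (fun i => arcDifference o (g i)) h
  let d : G.edgeSet → ℝ := fun e => if e ∈ L ∨ ∃ i ∈ T, g i = e then 1 else 0
  refine ⟨d, fun l hl => by simp [d, hl], fun x hx hinj => hT x hx ?_⟩
  by_contra! hne
  let S := {i : I // i ∈ T ∧ arcDifference o (g i) x ≠ 0}
  have : Nonempty S := let ⟨i, hi, hix⟩ := hne; ⟨⟨i, hi, hix⟩⟩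
  -- The injection at `k` vanishes but its `g k` term does not, so another term is nonzero; its line
  -- has nonzero weight and is not in `L`, hence is chosen by some `j` in `S`.
  have hnext (k : S) : ∃ j : S, j ≠ k ∧ ((k : I) : V) ∈ (g j : Sym2 V) := by
    have h0 := hinj k.1 k.1.2
    rw [injection_apply] at h0
    have hk : signedIncMatrix o k.1 (g k.1) * (d (g k.1) * arcDifference o (g k.1) x) ≠ 0 := by
      refine mul_ne_zero ((signedIncMatrix_ne_zero_iff _ _ _).2 (hg _))
        (mul_ne_zero ?_ k.2.2)
      simp only [d]
      rw [if_pos (Or.inr ⟨k.1, k.2.1, rfl⟩)]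
      exact one_ne_zero
    obtain ⟨e, hek, he⟩ : ∃ e ≠ g k.1,
        signedIncMatrix o k.1 e * (d e * arcDifference o e x) ≠ 0 := by
      by_contra! hall
      exact hk ((Finset.sum_eq_single (g k.1) (fun e _ he => hall e he) (by simp)).symm.trans h0)
    simp only [ne_eq, mul_eq_zero, not_or] at he
    obtain ⟨hinc, hde, hex⟩ := he
    have : ∃ i ∈ T, g i = e := by
      by_contra hno
      exact hde (if_neg fun hor => hor.elim (fun hl => hex (hx.1 e hl)) hno)
    obtain ⟨j, hj, rfl⟩ := this
    refine ⟨⟨j, hj, hex⟩, fun hjk => hek (by rw [← hjk]), ?_⟩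
    exact (signedIncMatrix_ne_zero_iff _ _ _).1 hinc
  choose next hnext_ne hnext_mem using hnext
  have hends (k : S) : (g (next k) : Sym2 V) = s(((next k : I) : V), ((k : I) : V)) := by
    refine ((Sym2.mem_and_mem_iff ?_).1 ⟨hg _, hnext_mem k⟩)
    exact fun heq => hnext_ne k (Subtype.ext (Subtype.ext heq))
  -- The line of `next k` joins `next k` to `k`, so it determines `k`. By finiteness every line
  -- chosen in `S` then has both ends in `S`.
  have hinjective : Function.Injective next := by
    intro k k' hkk
    have h1 := hends k
    rw [hkk, hends k', Sym2.congr_right] at h1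
    exact Subtype.ext (Subtype.ext h1.symm)
  have hsurj : Function.Surjective next := Finite.surjective_of_injective hinjective
  have hmem (j : S) (v : V) (hv : v ∈ (g j : Sym2 V)) : ∃ k : S, ((k : I) : V) = v := by
    obtain ⟨k, rfl⟩ := hsurj j
    rw [hends, Sym2.mem_iff] at hv
    obtain rfl | rfl := hv
    exacts [⟨_, rfl⟩, ⟨_, rfl⟩]
  -- Each row holds one +1 and one -1, as both ends of the line are in `S`.
  obtain ⟨c, hc, hcM⟩ := Matrix.exists_vecMul_eq_zero_of_row_sum_eq_zero
    (Matrix.of fun j k : S => signedIncMatrix o k.1 (g j.1)) fun j => by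
      obtain ⟨a, ha⟩ := hmem j (o.tail (g j)) ((o.mem_iff _ _).2 (Or.inl rfl))
      obtain ⟨b, hb⟩ := hmem j (o.head (g j)) ((o.mem_iff _ _).2 (Or.inr rfl))
      have := sum_signedIncMatrix_mul o (f := fun k : S => ((k : I) : V))
        (fun k k' hkk => Subtype.ext (Subtype.ext hkk)) ha hb 1
      simpa [arcDifference_apply] using this
  have hcol (v : V) : ∑ j : S, c j * signedIncMatrix o v (g j) = 0 := by
    by_cases hv : ∃ k : S, ((k : I) : V) = v
    · obtain ⟨k, rfl⟩ := hv
      exact congrFun hcM k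
    · refine Finset.sum_eq_zero fun j _ => ?_
      have : ¬ signedIncMatrix o v (g j) ≠ 0 := fun h0 =>
        hv (hmem j v ((signedIncMatrix_ne_zero_iff _ _ _).1 h0))
      rw [not_not.1 this, mul_zero]
  obtain ⟨k, hk⟩ := Function.ne_iff.1 hc
  -- Evaluated at this `y`, the dependency `c` keeps only its `k` term, which is nonzero.
  obtain ⟨y, -, hy0, hyk⟩ := hmin k.1 k.2.1
  have hsum : ∑ j : S, c j * arcDifference o (g j) y = 0 := by
    simp only [arcDifference_eq_sum, Finset.mul_sum, ← mul_assoc]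
    rw [Finset.sum_comm]
    simp [← Finset.sum_mul, hcol]
  rw [Finset.sum_eq_single k (fun j _ hjk => by
    rw [hy0 j.1 j.2.1 (fun heq => hjk (Subtype.ext heq)), mul_zero]) (by simp)] at hsum
  exact (mul_ne_zero hk hyk) hsum

end PowerNetwork

/-! ### The equivalence -/

open PowerNetwork in
theorem proposition1 {V : Type*} [Fintype V] [DecidableEq V] (G : SimpleGraph V)
    [Fintype G.edgeSet] (o : PowerNetwork.ArcDirection G)
    (I : Set V) (L : Set G.edgeSet) (P : Set V)
    (hIP : ∀ i ∈ I ∩ P, ∃ j, G.Adj i j) :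
    PowerNetwork.TopologicallyObservable o I L P ↔
      ∃ g : I → G.edgeSet, (∀ i : I, (i : V) ∈ (g i : Sym2 V)) ∧
        (PowerNetwork.augmentedGraph L P g).Connected := by
  simp only [topologicallyObservable_iff_exists, Matrix.rank_eq_card_iff,
    protectedMatrix_mulVec_eq_zero_iff, augmentedGraph_connected_iff o]
  constructor
  · rintro ⟨d, hd⟩
    refine exists_transversal_linear_tests (groundedPotentials o L P)
      (fun i : I => injection o d i) (arcDifference o) (fun i => {e | (i : V) ∈ (e : Sym2 V)})
      (fun i => ?_) (fun i x hx => ?_)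
      fun x hx hinj => hd x ⟨fun i hi => hinj ⟨i, hi⟩, fun l hl => by simp [hx.1 l hl], hx.2⟩
    · by_cases hi : (i : V) ∈ P
      · obtain ⟨j, hj⟩ := hIP i ⟨i.2, hi⟩
        exact ⟨⟨s(i, j), hj⟩, Sym2.mem_mk_left _ _⟩
      -- If `i` were isolated and outside `P`, the unit potential at `i` would lie in the kernel.
      · by_contra hempty
        have hno (e : G.edgeSet) : arcDifference o e (Pi.single (i : V) 1) = 0 := by
          have hie : ¬ (i : V) ∈ (e : Sym2 V) := fun hie => hempty ⟨e, hie⟩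
          rw [o.mem_iff, not_or] at hie
          simp [arcDifference_apply, Ne.symm hie.1, Ne.symm hie.2]
        have := hd (Pi.single (i : V) 1) ⟨fun v _ => by simp [injection_apply, hno],
          fun l _ => by simp [hno], fun v hv => Pi.single_eq_of_ne (by rintro rfl; exact hi hv) _⟩
        simpa using congrFun this i
    · rw [injection_apply]
      refine Finset.sum_eq_zero fun e _ => ?_
      by_cases hie : (i : V) ∈ (e : Sym2 V)
      · rw [hx e hie, mul_zero, mul_zero]
      · rw [not_not.1 (mt (signedIncMatrix_ne_zero_iff o i e).1 hie), zero_mul]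
  · rintro ⟨g, hg, h⟩
    obtain ⟨d, hdL, hd⟩ := exists_weights_of_forall_eq_zero o I L P g hg h
    exact ⟨d, fun x ⟨hI, hL, hP⟩ =>
      hd x ⟨fun l hl => (mul_eq_zero.1 (hL l hl)).resolve_left (hdL l hl), hP⟩ hI⟩
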